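/- Let $H$ be a complex Hilbert space and let $T$ be a bounded linear operator on $H$ whose numerical range $W(T):=\{\langle Tx,x\rangle: x\in H,\ \|x\|=1\}$ is contained in the closed unit disk $\overline{\mathbb D}$. Let $f:\overline{\mathbb D}\to\overline{\mathbb D}$ be a function in the disk algebra, that is, continuous on $\overline{\mathbb D}$ and holomorphic on the open unit disk $\mathbb D$, with Taylor series $f(z)=\sum_{n\ge0}a_nz^n$ on $\mathbb D$. Then for every $r\in[0,1)$ the series $f(rT):=\sum_{n\ge0}a_n(rT)^n$ is (unconditionally) summable in the operator norm, the limit $$f(T):=\lim_{r\to1^-}f(rT)$$ exists in the operator norm, and $$W(f(T))\subset \operatorname{teardrop}(f(0)),$$ where, for $\alpha\in\overline{\mathbb D}$, $\operatorname{teardrop}(\alpha)$ is the convex hull of the union of the closed unit disk and the closed disk of center $\alpha$ and radius $1-|\alpha|^2$. -/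

import Mathlib

open Filter Topology

namespace Drury

noncomputable section

variable {H : Type*} [NormedAddCommGroup H] [InnerProductSpace ℂ H]

/-- The numerical range `W(T) = {⟨Tx, x⟩ : ‖x‖ = 1}`. The inner product `⟨u, v⟩` that is linear in
`u` is Mathlib's `inner ℂ v u`, which is linear in its second argument. -/
def numericalRange (T : H →L[ℂ] H) : Set ℂ :=
  {z : ℂ | ∃ x : H, ‖x‖ = 1 ∧ z = inner ℂ x (T x)}

/-- `teardrop α` is the convex hull of the union of the closed unit disk and the closed disk of
center `α` and radius `1 - |α|²`. -/
def teardrop (α : ℂ) : Set ℂ :=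
  convexHull ℝ (Metric.closedBall (0 : ℂ) 1 ∪ Metric.closedBall α (1 - ‖α‖ ^ 2))

/-- The `n`-th Taylor coefficient of `f` at `0`. -/
def taylorCoeff (f : ℂ → ℂ) (n : ℕ) : ℂ :=
  iteratedDeriv n f 0 / (n.factorial : ℂ)

/-- The operator `f(A) = ∑ aₙ Aⁿ` (convergence in operator norm), for `f` holomorphic in the open
unit disk with Taylor coefficients `aₙ`, meant for operators `A` with spectrum inside the open unit
disk. -/
def holoCalc (f : ℂ → ℂ) (A : H →L[ℂ] H) : H →L[ℂ] H :=
  ∑' n : ℕ, taylorCoeff f n • A ^ n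

/-- The operator `f(T) = lim_{r → 1⁻} f(rT)` (limit in operator norm), for `f` in the disk
algebra. -/
def diskCalc (f : ℂ → ℂ) (T : H →L[ℂ] H) : H →L[ℂ] H :=
  limUnder (𝓝[<] (1 : ℝ)) (fun r : ℝ => holoCalc f ((r : ℂ) • T))

end

end Drury

open scoped ComplexConjugate

namespace Drury

/-! ### Numerical radius: the factor 2, its refinement, and the power inequality. -/

section

variable {H : Type*} [NormedAddCommGroup H] [InnerProductSpace ℂ H]

/-! A compact convex set is cut out by its supporting half-planes, and the teardrop of α has support
function max(1, Re(uα) + 1 - |α|²) in the direction u. Replacing f by uf, it suffices to bound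
Re⟨f(rT)x, x⟩ in one direction; this is `re_inner_holoCalc_le_max`, and the limit r → 1 then
finishes.

For that bound, put α = f(0) and let g be f followed by the disk automorphism sending α to 0. By
Berger–Stampfli (`NumRadiusLeOne.holoCalc`), S = g(rT) has numerical radius at most one. Writing x =
(1 + ᾱS)y gives f(rT)x = (α + S)y, so only an inequality about one operator S and one vector y
remains, `re_inner_mobius_le`. Its hard case rests on `norm_sq_apply_le`, which sharpens ‖S‖ ≤ 2
vector by vector.

Berger–Stampfli follows from an operator Herglotz formula, `re_inner_holoCalc_nonneg`, applied to
the Cayley transform (1 + g)/(1 - g). Applied to differences of dilates of f, it also makes f(rT)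
Cauchy as r → 1. -/

/-- The numerical radius of `T` is at most one. -/
def NumRadiusLeOne (T : H →L[ℂ] H) : Prop := ∀ x : H, ‖inner ℂ x (T x)‖ ≤ ‖x‖ ^ 2

lemma numRadiusLeOne_of_numericalRange {T : H →L[ℂ] H}
    (hT : numericalRange T ⊆ Metric.closedBall (0 : ℂ) 1) : NumRadiusLeOne T := by
  intro x
  rcases eq_or_ne x 0 with rfl | hx
  · simp
  have hx' : ‖x‖ ≠ 0 := norm_ne_zero_iff.mpr hx
  have h1 : ‖((‖x‖⁻¹ : ℝ) : ℂ) • x‖ = 1 := by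
    rw [norm_smul, Complex.norm_real, norm_inv, norm_norm, inv_mul_cancel₀ hx']
  have h2 := hT ⟨_, h1, rfl⟩
  rw [mem_closedBall_zero_iff, map_smul, inner_smul_left, inner_smul_right, Complex.conj_ofReal,
    ← mul_assoc, norm_mul, norm_mul, Complex.norm_real, norm_inv, norm_norm] at h2
  have hpos : 0 < ‖x‖ := norm_pos_iff.mpr hx
  field_simp at h2
  linarith

lemma exists_norm_one_mul_eq_norm (z : ℂ) : ∃ u : ℂ, ‖u‖ = 1 ∧ u * z = ‖z‖ := by
  rcases eq_or_ne z 0 with rfl | hz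
  · exact ⟨1, by simp, by simp⟩
  · have hz' : (‖z‖ : ℂ) ≠ 0 := by exact_mod_cast norm_ne_zero_iff.mpr hz
    refine ⟨conj z / ‖z‖, ?_, ?_⟩
    · rw [norm_div, RCLike.norm_conj, Complex.norm_real, norm_norm,
        div_self (norm_ne_zero_iff.mpr hz)]
    · rw [div_mul_eq_mul_div, mul_comm, Complex.mul_conj, Complex.normSq_eq_norm_sq]
      push_cast
      field_simp

lemma norm_le_of_forall_re_mul_le {z : ℂ} {c : ℝ} (h : ∀ u : ℂ, ‖u‖ = 1 → (u * z).re ≤ c) :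
    ‖z‖ ≤ c := by
  obtain ⟨u, hu, huz⟩ := exists_norm_one_mul_eq_norm z
  have := h u hu
  rwa [huz, Complex.ofReal_re] at this

lemma NumRadiusLeOne.smul {T : H →L[ℂ] H} (hT : NumRadiusLeOne T) {u : ℂ} (hu : ‖u‖ ≤ 1) :
    NumRadiusLeOne (u • T) := by
  intro x
  rw [smul_apply, inner_smul_right, norm_mul]
  nlinarith [hT x, norm_nonneg (inner ℂ x (T x)), norm_nonneg u]

lemma NumRadiusLeOne.re_inner_le {T : H →L[ℂ] H} (hT : NumRadiusLeOne T) (x : H) :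
    (inner ℂ x (T x)).re ≤ ‖x‖ ^ 2 :=
  (Complex.re_le_norm _).trans (hT x)

lemma inner_self_eq_ofReal (x : H) : inner ℂ x x = ((‖x‖ ^ 2 : ℝ) : ℂ) := by
  rw [inner_self_eq_norm_sq_to_K]; simp

lemma NumRadiusLeOne.re_inner_one_sub_nonneg {T : H →L[ℂ] H} (hT : NumRadiusLeOne T) (x : H) :
    0 ≤ (inner ℂ x (x - T x)).re := by
  rw [inner_sub_right, inner_self_eq_ofReal, Complex.sub_re, Complex.ofReal_re]
  linarith [hT.re_inner_le x]

/-- An entire function whose real part is nonnegative on the unit circle has nonnegative real part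
on the unit disk. -/
lemma re_nonneg_of_forall_sphere {P : ℂ → ℂ} (hP : Differentiable ℂ P)
    (h : ∀ z : ℂ, ‖z‖ = 1 → 0 ≤ (P z).re) {z : ℂ} (hz : ‖z‖ ≤ 1) : 0 ≤ (P z).re := by
  -- Maximum modulus for exp(-P), since |exp(-P)| = exp(-Re P).
  have hd : Differentiable ℂ fun w => Complex.exp (-P w) := hP.neg.cexp
  have := Complex.norm_le_of_forall_mem_frontier_norm_le (U := Metric.ball (0 : ℂ) 1) (C := 1)
    (z := z) Metric.isBounded_ball hd.diffContOnCl (fun w hw => by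
      rw [frontier_ball _ one_ne_zero, mem_sphere_zero_iff_norm] at hw
      rw [Complex.norm_exp, Real.exp_le_one_iff]
      simpa using h w hw) (by
      rw [closure_ball _ one_ne_zero]; simpa using hz)
  rw [Complex.norm_exp, Real.exp_le_one_iff] at this
  simpa using this

/-- A local refinement of the estimate `‖S‖ ≤ 2 w(S)`. -/
lemma NumRadiusLeOne.norm_sq_apply_le {S : H →L[ℂ] H} (hS : NumRadiusLeOne S) {c : ℝ}
    (hc0 : 0 ≤ c) (hc1 : c ≤ 1) (y : H) :
    (1 - c ^ 2) / 4 * ‖S y‖ ^ 2 ≤ ‖y‖ ^ 2 - c * (inner ℂ y (S y)).re := by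
  obtain ⟨z, hz⟩ : ∃ z : H, S y = (2 : ℂ) • z := ⟨(2⁻¹ : ℂ) • S y, by simp [smul_smul]⟩
  obtain ⟨v, hv⟩ : ∃ v : H, v = y - (c : ℂ) • z := ⟨_, rfl⟩
  -- On |w| = 1, Re P(w) = Re⟨(1 - wS)(v + wz), v + wz⟩: use w̄w = 1 and trade the w̄ term for its
  -- conjugate, which makes P a polynomial in w. Positivity then passes to the interior point w = c,
  -- where v + cz = y.
  let P : ℂ → ℂ := fun w => inner ℂ v v + inner ℂ z z + 2 * w * inner ℂ v z - w * inner ℂ v (S v)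
    - inner ℂ z (S v) - w ^ 2 * inner ℂ v (S z) - w * inner ℂ z (S z)
  have hP : Differentiable ℂ P := by fun_prop
  have hcirc : ∀ w : ℂ, ‖w‖ = 1 → 0 ≤ (P w).re := by
    intro w hw
    have hw' : conj w * w = 1 := by
      rw [mul_comm, Complex.mul_conj, Complex.normSq_eq_norm_sq, hw]; simp
    have key := (hS.smul hw.le).re_inner_one_sub_nonneg (v + w • z)
    have e : inner ℂ (v + w • z) (v + w • z - (w • S) (v + w • z)) =
        P w + (inner ℂ (w • z) v - inner ℂ v (w • z)) := by
      simp only [P, smul_apply, map_add, map_smul, inner_add_left,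
        inner_add_right, inner_sub_right, inner_smul_left, inner_smul_right]
      linear_combination (inner ℂ z z - inner ℂ z (S v) - w * inner ℂ z (S z)) * hw'
    have e2 : (inner ℂ (w • z) v - inner ℂ v (w • z)).re = 0 := by
      rw [← inner_conj_symm v, Complex.sub_re, Complex.conj_re, sub_self]
    rw [e, Complex.add_re, e2, add_zero] at key
    exact key
  have hPc := re_nonneg_of_forall_sphere hP hcirc (z := (c : ℂ)) (by
    rw [Complex.norm_real, Real.norm_eq_abs, abs_of_nonneg hc0]; exact hc1)
  have e3 : P c = inner ℂ y y - c * inner ℂ y z - c * inner ℂ z y - (1 - c ^ 2) * inner ℂ z z := by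
    simp only [P, hv, map_sub, map_smul, hz, inner_sub_left, inner_sub_right, inner_smul_left,
      inner_smul_right, Complex.conj_ofReal]
    ring
  have e4 : (inner ℂ z y).re = (inner ℂ y z).re := by
    rw [← inner_conj_symm, Complex.conj_re]
  rw [e3, inner_self_eq_ofReal, inner_self_eq_ofReal] at hPc
  simp only [← Complex.ofReal_pow, ← Complex.ofReal_one, ← Complex.ofReal_sub, Complex.sub_re,
    Complex.re_ofReal_mul, Complex.ofReal_re, e4] at hPc
  rw [hz, norm_smul, inner_smul_right]
  simp only [Complex.mul_re, Complex.re_ofNat, Complex.im_ofNat, Complex.norm_ofNat]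
  linarith

lemma NumRadiusLeOne.norm_le_two {S : H →L[ℂ] H} (hS : NumRadiusLeOne S) : ‖S‖ ≤ 2 := by
  refine S.opNorm_le_bound zero_le_two fun y => ?_
  -- The case c = 0.
  have := hS.norm_sq_apply_le le_rfl zero_le_one y
  refine abs_le_of_sq_le_sq' (?_ : ‖S y‖ ^ 2 ≤ (2 * ‖y‖) ^ 2) (by positivity) |>.2
  nlinarith

/-- For ζ a primitive n-th root of unity, 1 - Tⁿ = (1 - ζʲT)pⱼ with pⱼ a geometric sum, and the pⱼ
average to the identity. Hence Re⟨(1 - Tⁿ)x, x⟩ is the mean of the nonnegative numbers Re⟨(1 -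
ζʲT)pⱼx, pⱼx⟩. -/
lemma NumRadiusLeOne.re_inner_pow_le {T : H →L[ℂ] H} (hT : NumRadiusLeOne T) {n : ℕ} (hn : n ≠ 0)
    (x : H) : (inner ℂ x ((T ^ n) x)).re ≤ ‖x‖ ^ 2 := by
  obtain ⟨ζ, hζ⟩ : ∃ ζ : ℂ, IsPrimitiveRoot ζ n := ⟨_, Complex.isPrimitiveRoot_exp n hn⟩
  let p : ℕ → H →L[ℂ] H := fun j => ∑ m ∈ Finset.range n, (ζ ^ j • T) ^ m
  have hmul : ∀ j, (1 - ζ ^ j • T) * p j = 1 - T ^ n := by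
    intro j
    rw [mul_neg_geom_sum, smul_pow, ← pow_mul, mul_comm j n, pow_mul, hζ.pow_eq_one, one_pow,
      one_smul]
  have hsum : ∑ j ∈ Finset.range n, p j = (n : ℂ) • (1 : H →L[ℂ] H) := by
    simp only [p, smul_pow]
    rw [Finset.sum_comm]
    simp only [← Finset.sum_smul]
    rw [Finset.sum_eq_single_of_mem 0 (Finset.mem_range.mpr (Nat.pos_of_ne_zero hn))]
    · simp
    · intro m hm hm0
      have h1 : ζ ^ m ≠ 1 := hζ.pow_ne_one_of_pos_of_lt hm0 (Finset.mem_range.mp hm)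
      have h2 : (ζ ^ m - 1) * ∑ j ∈ Finset.range n, (ζ ^ m) ^ j = 0 := by
        rw [mul_geom_sum, ← pow_mul, mul_comm, pow_mul, hζ.pow_eq_one, one_pow, sub_self]
      have h3 := (mul_eq_zero.mp h2).resolve_left (sub_ne_zero.mpr h1)
      simp only [← pow_mul] at h3 ⊢
      simp only [mul_comm m] at h3
      rw [h3, zero_smul]
  have hj : ∀ j ∈ Finset.range n, 0 ≤ (inner ℂ (p j x) ((1 - T ^ n) x)).re := by
    intro j _
    have h1 := (hT.smul (u := ζ ^ j) (by
      rw [norm_pow, hζ.norm'_eq_one hn, one_pow])).re_inner_one_sub_nonneg (p j x)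
    have h2 : p j x - (ζ ^ j • T) (p j x) = (1 - T ^ n) x := by rw [← hmul j]; rfl
    rwa [h2] at h1
  have h := Finset.sum_nonneg hj
  rw [← Complex.re_sum, ← sum_inner, ← sum_apply, hsum] at h
  simp only [smul_apply, one_apply_eq_self,
    sub_apply, inner_smul_left, inner_sub_right, Complex.conj_natCast,
    inner_self_eq_ofReal] at h
  rw [← mul_sub, ← Complex.ofReal_natCast, Complex.re_ofReal_mul, Complex.sub_re,
    Complex.ofReal_re] at h
  have hn' : (0 : ℝ) < n := by exact_mod_cast Nat.pos_of_ne_zero hn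
  linarith [nonneg_of_mul_nonneg_right h hn']

lemma NumRadiusLeOne.of_forall_re {T : H →L[ℂ] H}
    (h : ∀ u : ℂ, ‖u‖ = 1 → ∀ x, (inner ℂ x ((u • T) x)).re ≤ ‖x‖ ^ 2) : NumRadiusLeOne T := by
  intro x
  refine norm_le_of_forall_re_mul_le fun u hu => ?_
  have := h u hu x
  rwa [smul_apply, inner_smul_right] at this

/-- Berger's power inequality. -/
lemma NumRadiusLeOne.pow {T : H →L[ℂ] H} (hT : NumRadiusLeOne T) {n : ℕ} (hn : n ≠ 0) :
    NumRadiusLeOne (T ^ n) := by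
  refine NumRadiusLeOne.of_forall_re fun u hu x => ?_
  -- An n-th root absorbs the rotation: uTⁿ = (vT)ⁿ.
  obtain ⟨v, hv⟩ := IsAlgClosed.exists_pow_nat_eq u (Nat.pos_of_ne_zero hn)
  have hv1 : ‖v‖ = 1 := by
    rw [← hv, norm_pow] at hu
    exact (pow_eq_one_iff_of_nonneg (norm_nonneg v) hn).mp hu
  rw [← hv, ← smul_pow]
  exact (hT.smul hv1.le).re_inner_pow_le hn x

lemma NumRadiusLeOne.norm_pow_le_two {T : H →L[ℂ] H} (hT : NumRadiusLeOne T) (n : ℕ) :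
    ‖T ^ n‖ ≤ 2 := by
  rcases eq_or_ne n 0 with rfl | hn
  · rw [pow_zero]
    exact (ContinuousLinearMap.norm_id_le (𝕜 := ℂ) (E := H)).trans one_le_two
  · exact (hT.pow hn).norm_le_two

end

/-! ### Taylor coefficients, the power series calculus, and circle averages. -/

section

variable {H : Type*} [NormedAddCommGroup H] [InnerProductSpace ℂ H]

lemma hasSum_taylorCoeff {F : ℂ → ℂ} (hF : DifferentiableOn ℂ F (Metric.ball 0 1)) {z : ℂ}
    (hz : ‖z‖ < 1) : HasSum (fun n => taylorCoeff F n * z ^ n) (F z) := by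
  have h := Complex.hasSum_taylorSeries_on_ball hF (z := z) (by simpa using hz)
  have e : (fun n => taylorCoeff F n * z ^ n) =
      fun n => (n.factorial : ℂ)⁻¹ • (z - 0) ^ n • iteratedDeriv n F 0 := by
    funext n
    simp only [taylorCoeff, sub_zero, smul_eq_mul]
    ring
  rwa [e]

lemma taylorCoeff_eq_of_hasSum {F : ℂ → ℂ} {a : ℕ → ℂ}
    (h : ∀ z : ℂ, ‖z‖ < 1 → HasSum (fun n => a n * z ^ n) (F z)) : taylorCoeff F = a := by
  have h1 : HasFPowerSeriesAt F (FormalMultilinearSeries.ofScalars ℂ a) 0 := by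
    rw [hasFPowerSeriesAt_iff]
    filter_upwards [Metric.ball_mem_nhds (0 : ℂ) one_pos] with z hz
    simpa [mul_comm] using h z (by simpa using hz)
  have h2 := h1.eq_formalMultilinearSeries h1.analyticAt.hasFPowerSeriesAt
  ext n
  have h3 := congrArg (fun p => FormalMultilinearSeries.coeff p n) h2
  simpa [taylorCoeff] using h3.symm

lemma taylorCoeff_const (c : ℂ) (n : ℕ) :
    taylorCoeff (fun _ => c) n = if n = 0 then c else 0 := by
  rw [taylorCoeff, iteratedDeriv_const]
  split_ifs with h <;> simp [h]

section

variable {F G : ℂ → ℂ} (hF : DifferentiableOn ℂ F (Metric.ball 0 1))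
  (hG : DifferentiableOn ℂ G (Metric.ball 0 1))
include hF

lemma contDiffAt_zero (n : ℕ) : ContDiffAt ℂ n F 0 :=
  (hF.analyticAt (Metric.ball_mem_nhds _ one_pos)).contDiffAt

lemma taylorCoeff_const_mul (c : ℂ) (n : ℕ) :
    taylorCoeff (fun z => c * F z) n = c * taylorCoeff F n := by
  rw [taylorCoeff, iteratedDeriv_const_mul _ (contDiffAt_zero hF n), taylorCoeff, mul_div_assoc]

lemma taylorCoeff_comp_const_mul {c : ℂ} (hc : ‖c‖ ≤ 1) (n : ℕ) :
    taylorCoeff (fun z => F (c * z)) n = c ^ n * taylorCoeff F n := by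
  refine congrFun (taylorCoeff_eq_of_hasSum (a := fun n => c ^ n * taylorCoeff F n)
    fun z hz => ?_) n
  have h : ‖c * z‖ < 1 := by
    rw [norm_mul]; exact mul_lt_one_of_nonneg_of_lt_one_right hc (norm_nonneg z) hz
  convert hasSum_taylorCoeff hF h using 2 with n
  rw [mul_pow]; ring

include hG

lemma taylorCoeff_add (n : ℕ) :
    taylorCoeff (fun z => F z + G z) n = taylorCoeff F n + taylorCoeff G n := by
  simp only [taylorCoeff]
  rw [← add_div, ← iteratedDeriv_add (contDiffAt_zero hF n) (contDiffAt_zero hG n)]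
  rfl

lemma taylorCoeff_mul (n : ℕ) : taylorCoeff (fun z => F z * G z) n =
    ∑ k ∈ Finset.range (n + 1), taylorCoeff F k * taylorCoeff G (n - k) := by
  rw [taylorCoeff, iteratedDeriv_fun_mul (contDiffAt_zero hF n) (contDiffAt_zero hG n),
    Finset.sum_div]
  refine Finset.sum_congr rfl fun k hk => ?_
  have hk' : k ≤ n := Nat.lt_succ_iff.mp (Finset.mem_range.mp hk)
  have h : ((n.choose k : ℕ) : ℂ) * (k.factorial : ℂ) * ((n - k).factorial : ℂ) = n.factorial := by
    exact_mod_cast Nat.choose_mul_factorial_mul_factorial hk'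
  have h1 : (k.factorial : ℂ) ≠ 0 := by exact_mod_cast k.factorial_ne_zero
  have h2 : ((n - k).factorial : ℂ) ≠ 0 := by exact_mod_cast (n - k).factorial_ne_zero
  have h3 : (n.factorial : ℂ) ≠ 0 := by exact_mod_cast n.factorial_ne_zero
  simp only [taylorCoeff]
  field_simp
  rw [← h]
  ring

end

/-- The summability hypothesis under which the calculus is multiplicative: the power series of
every function holomorphic in the unit disk converges absolutely at `A`. -/
def HasDiskCalc (A : H →L[ℂ] H) : Prop :=
  ∀ F : ℂ → ℂ, DifferentiableOn ℂ F (Metric.ball 0 1) →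
    Summable fun n => ‖taylorCoeff F n • A ^ n‖

/-- Since ‖Tⁿ‖ ≤ 2 for all n, the terms are dominated by 2|aₙ|rⁿ. -/
lemma NumRadiusLeOne.hasDiskCalc {T : H →L[ℂ] H} (hT : NumRadiusLeOne T) {r : ℝ} (hr0 : 0 ≤ r)
    (hr1 : r < 1) : HasDiskCalc ((r : ℂ) • T) := by
  intro F hF
  have hr : ‖(r : ℂ)‖ = r := by rw [Complex.norm_real, Real.norm_eq_abs, abs_of_nonneg hr0]
  have h := (hasSum_taylorCoeff hF (z := r) (by rwa [hr])).summable.norm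
  refine Summable.of_nonneg_of_le (fun _ => norm_nonneg _) (fun n => ?_) (h.mul_right 2)
  rw [smul_pow, smul_smul, norm_smul]
  exact mul_le_mul_of_nonneg_left (hT.norm_pow_le_two n) (norm_nonneg _)

lemma holoCalc_const (c : ℂ) (A : H →L[ℂ] H) : holoCalc (fun _ => c) A = c • 1 := by
  rw [holoCalc, tsum_eq_single 0 fun n hn => by rw [taylorCoeff_const, if_neg hn, zero_smul]]
  rw [taylorCoeff_const, if_pos rfl, pow_zero]

lemma holoCalc_congr {F G : ℂ → ℂ} (h : Set.EqOn F G (Metric.ball 0 1)) (A : H →L[ℂ] H) :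
    holoCalc F A = holoCalc G A := by
  have : ∀ n, taylorCoeff F n = taylorCoeff G n := fun n => by
    rw [taylorCoeff, taylorCoeff, (h.eventuallyEq_of_mem
      (Metric.ball_mem_nhds (0 : ℂ) one_pos)).iteratedDeriv_eq]
  simp only [holoCalc, this]

lemma holoCalc_const_mul {F : ℂ → ℂ} (hF : DifferentiableOn ℂ F (Metric.ball 0 1)) (c : ℂ)
    (A : H →L[ℂ] H) : holoCalc (fun z => c * F z) A = c • holoCalc F A := by
  simp only [holoCalc, taylorCoeff_const_mul hF, mul_smul, tsum_const_smul'']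

lemma holoCalc_comp_const_mul {F : ℂ → ℂ} (hF : DifferentiableOn ℂ F (Metric.ball 0 1)) {c : ℂ}
    (hc : ‖c‖ ≤ 1) (A : H →L[ℂ] H) :
    holoCalc (fun z => F (c * z)) A = holoCalc F (c • A) := by
  simp only [holoCalc, taylorCoeff_comp_const_mul hF hc, smul_pow, smul_smul, mul_comm]

variable [CompleteSpace H]

section

variable {A : H →L[ℂ] H} (hA : HasDiskCalc A)
  {F G : ℂ → ℂ} (hF : DifferentiableOn ℂ F (Metric.ball 0 1))
  (hG : DifferentiableOn ℂ G (Metric.ball 0 1))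
include hA hF hG

lemma holoCalc_add : holoCalc (fun z => F z + G z) A = holoCalc F A + holoCalc G A := by
  simp only [holoCalc, taylorCoeff_add hF hG, add_smul]
  exact (hA F hF).of_norm.tsum_add (hA G hG).of_norm

lemma holoCalc_sub : holoCalc (fun z => F z - G z) A = holoCalc F A - holoCalc G A := by
  have h := holoCalc_add hA hF (hG.const_mul (-1))
  rw [holoCalc_const_mul hG] at h
  simpa [sub_eq_add_neg] using h

lemma holoCalc_mul : holoCalc (fun z => F z * G z) A = holoCalc F A * holoCalc G A := by
  simp only [holoCalc]
  rw [tsum_mul_tsum_eq_tsum_sum_range_of_summable_norm (hA F hF) (hA G hG)]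
  refine tsum_congr fun n => ?_
  rw [taylorCoeff_mul hF hG, Finset.sum_smul]
  refine Finset.sum_congr rfl fun k hk => ?_
  rw [smul_mul_smul_comm, ← pow_add,
    Nat.add_sub_of_le (Nat.lt_succ_iff.mp (Finset.mem_range.mp hk))]

end

lemma circleAverage_mul_inv_pow {Q : ℂ → ℂ} (hQ : DifferentiableOn ℂ Q (Metric.ball 0 1)) {R : ℝ}
    (hR0 : 0 < R) (hR1 : R < 1) (n : ℕ) :
    Real.circleAverage (fun z => Q z * z⁻¹ ^ n) 0 R = taylorCoeff Q n := by
  lift R to NNReal using hR0.le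
  have h1 := ((hQ.mono (Metric.closedBall_subset_ball hR1)).hasFPowerSeriesOnBall
    (by exact_mod_cast hR0)).hasFPowerSeriesAt
  have h2 := h1.eq_formalMultilinearSeries h1.analyticAt.hasFPowerSeriesAt
  have h3 := congrArg (fun p => p n fun _ => (1 : ℂ)) h2
  rw [Real.circleAverage_eq_circleIntegral hR0.ne']
  simp only [cauchyPowerSeries_apply, FormalMultilinearSeries.ofScalars_apply_eq, one_pow,
    smul_eq_mul, mul_one] at h3
  rw [taylorCoeff, ← h3]
  simp only [smul_eq_mul, sub_zero]
  congr 2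
  funext z
  ring

lemma circleAverage_conj_mul_inv_pow {Q : ℂ → ℂ} (hQ : DifferentiableOn ℂ Q (Metric.ball 0 1))
    {R : ℝ} (hR0 : 0 < R) (hR1 : R < 1) (n : ℕ) :
    Real.circleAverage (fun z => conj (Q z) * z⁻¹ ^ n) 0 R = if n = 0 then conj (Q 0) else 0 := by
  -- On |z| = R, 1/z is the conjugate of z/R², so the integrand is the conjugate of the holomorphic
  -- g, and the mean value property applies.
  let g : ℂ → ℂ := fun z => Q z * (z / (R : ℂ) ^ 2) ^ n
  have hg : DifferentiableOn ℂ g (Metric.ball 0 1) := by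
    refine hQ.mul (Differentiable.differentiableOn ?_)
    fun_prop
  have hg' : DiffContOnCl ℂ g (Metric.ball 0 |R|) := by
    rw [abs_of_pos hR0]
    refine DifferentiableOn.diffContOnCl (hg.mono ?_)
    rw [closure_ball _ hR0.ne']
    exact Metric.closedBall_subset_ball hR1
  have hcong : Set.EqOn (fun z => conj (Q z) * z⁻¹ ^ n) (Complex.conjCLE ∘ g)
      (Metric.sphere 0 |R|) := by
    intro z hz
    rw [abs_of_pos hR0, mem_sphere_zero_iff_norm] at hz
    have hz0 : z ≠ 0 := by rintro rfl; simp at hz; exact hR0.ne hz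
    have h1 : z * conj z = (R : ℂ) ^ 2 := by
      rw [Complex.mul_conj, Complex.normSq_eq_norm_sq, hz]; push_cast; rfl
    have h2 : conj z ≠ 0 := by simpa using hz0
    simp only [Function.comp_apply, g, Complex.conjCLE_apply, map_mul, map_pow, map_div₀, ← h1,
      Complex.conj_conj]
    field_simp
  have hint : CircleIntegrable g 0 R :=
    ContinuousOn.circleIntegrable hR0.le (hg.continuousOn.mono fun z hz => by
      rw [mem_sphere_zero_iff_norm] at hz; simpa [hz] using hR1)
  have h1 := ContinuousLinearMap.circleAverage_comp_comm (Complex.conjCLE : ℂ →L[ℝ] ℂ) hint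
  rw [Real.circleAverage_congr_sphere hcong]
  refine Eq.trans h1 ?_
  rw [hg'.circleAverage]
  rcases eq_or_ne n 0 with rfl | hn
  · simp [g]
  · simp [g, hn]

lemma hasSum_circleAverage {F : ℕ → ℂ → ℂ} {f : ℂ → ℂ} {b : ℕ → ℝ} {R : ℝ} (hR : 0 ≤ R)
    (hF : ∀ n, ContinuousOn (F n) (Metric.sphere 0 R))
    (hb : ∀ n, ∀ z ∈ Metric.sphere (0 : ℂ) R, ‖F n z‖ ≤ b n) (hb' : Summable b)
    (hf : ∀ z ∈ Metric.sphere (0 : ℂ) R, HasSum (fun n => F n z) (f z)) :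
    HasSum (fun n => Real.circleAverage (F n) 0 R) (Real.circleAverage f 0 R) := by
  have hmem : ∀ θ, circleMap 0 R θ ∈ Metric.sphere (0 : ℂ) R := circleMap_mem_sphere 0 hR
  simp only [Real.circleAverage]
  refine HasSum.const_smul _ (intervalIntegral.hasSum_integral_of_dominated_convergence
    (fun n _ => b n) (fun n => ?_) (fun n => ?_) ?_ ?_ ?_)
  · exact ((hF n).comp_continuous (continuous_circleMap 0 R) hmem).aestronglyMeasurable
  · exact Eventually.of_forall fun θ _ => hb n _ (hmem θ)
  · exact Eventually.of_forall fun θ _ => hb'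
  · exact intervalIntegrable_const
  · exact Eventually.of_forall fun θ _ => hf _ (hmem θ)

end

/-! ### The operator Herglotz inequality. -/

section

variable {H : Type*} [NormedAddCommGroup H] [InnerProductSpace ℂ H] [CompleteSpace H]

/-- With y = (1 - B)⁻¹x, the quantity equals Re⟨(1 - B)y, y⟩. -/
lemma NumRadiusLeOne.re_inner_tsum_pow_nonneg {B : H →L[ℂ] H} (hB : NumRadiusLeOne B)
    (hs : Summable fun n => B ^ n) (x : H) : 0 ≤ (inner ℂ x ((∑' n, B ^ n) x)).re := by
  obtain ⟨y, hy⟩ : ∃ y, y = (∑' n, B ^ n) x := ⟨_, rfl⟩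
  have h1 : (1 - B) * ∑' n, B ^ n = 1 := by
    rw [sub_mul, one_mul, ← hs.tsum_mul_left, hs.tsum_eq_zero_add, pow_zero]
    simp only [← pow_succ', add_sub_cancel_right]
  have h2 : y - B y = x := by
    rw [hy]; exact congrArg (fun C : H →L[ℂ] H => C x) h1
  have h3 := hB.re_inner_one_sub_nonneg y
  rw [h2, ← inner_conj_symm, Complex.conj_re] at h3
  rwa [← hy]

/-- An operator version of the Herglotz representation. -/
lemma NumRadiusLeOne.re_inner_holoCalc_nonneg {T : H →L[ℂ] H} (hT : NumRadiusLeOne T) {r : ℝ}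
    (hr0 : 0 ≤ r) (hr1 : r < 1) {Q : ℂ → ℂ} (hQ : DifferentiableOn ℂ Q (Metric.ball 0 1))
    (hre : ∀ z ∈ Metric.ball (0 : ℂ) 1, 0 ≤ (Q z).re) (x : H) :
    0 ≤ (inner ℂ x (holoCalc Q ((r : ℂ) • T) x)).re + (Q 0).re * ‖x‖ ^ 2 := by
  -- R > r makes ∑ (A/z)ⁿ converge on |z| = R; R < 1 keeps the circle inside the domain of Q.
  obtain ⟨R, hrR, hR1⟩ := exists_between hr1
  have hR0 : 0 < R := hr0.trans_lt hrR
  obtain ⟨A, hA⟩ : ∃ A, A = (r : ℂ) • T := ⟨_, rfl⟩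
  rw [← hA]
  have hAn : ∀ n, ‖A ^ n‖ ≤ 2 * r ^ n := by
    intro n
    rw [hA, smul_pow, norm_smul, norm_pow, Complex.norm_real, Real.norm_eq_abs, abs_of_nonneg hr0,
      mul_comm]
    exact mul_le_mul_of_nonneg_right (hT.norm_pow_le_two n) (by positivity)
  have hsph : ∀ z ∈ Metric.sphere (0 : ℂ) R, z ∈ Metric.ball (0 : ℂ) 1 := fun z hz => by
    rw [mem_sphere_zero_iff_norm] at hz; simpa [hz] using hR1
  have hQc : ContinuousOn Q (Metric.sphere (0 : ℂ) R) := hQ.continuousOn.mono hsph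
  have hne : ∀ z ∈ Metric.sphere (0 : ℂ) R, z ≠ 0 := fun z hz => by
    rw [mem_sphere_zero_iff_norm] at hz; rintro rfl; simp at hz; exact hR0.ne hz
  obtain ⟨M, hM⟩ := (isCompact_sphere (0 : ℂ) R).exists_bound_of_continuousOn hQc
  have hq : r / R < 1 := (div_lt_one hR0).mpr hrR
  have hgeo : Summable fun n => (r / R) ^ n := summable_geometric_of_lt_one (by positivity) hq
  let a : ℕ → ℂ := fun n => inner ℂ x ((A ^ n) x)
  have ha : ∀ n, ‖a n‖ ≤ 2 * r ^ n * ‖x‖ ^ 2 := by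
    intro n
    refine (norm_inner_le_norm _ _).trans ?_
    have := (A ^ n).le_of_opNorm_le (hAn n) x
    nlinarith [norm_nonneg x]
  let w : ℂ → ℂ := fun z => Q z + conj (Q z)
  have hw : ContinuousOn w (Metric.sphere 0 R) :=
    hQc.add (Complex.continuous_conj.comp_continuousOn hQc)
  have hpow : ∀ n, ContinuousOn (fun z : ℂ => z⁻¹ ^ n) (Metric.sphere (0 : ℂ) R) := fun n =>
    (continuousOn_id.inv₀ hne).pow n
  have hsumB : ∀ z ∈ Metric.sphere (0 : ℂ) R, Summable fun n => (z⁻¹ • A) ^ n := by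
    intro z hz
    rw [mem_sphere_zero_iff_norm] at hz
    refine Summable.of_norm_bounded (hgeo.mul_left 2) fun n => ?_
    rw [smul_pow, norm_smul, norm_pow, norm_inv, hz, div_pow, mul_div_assoc', div_eq_inv_mul,
      inv_pow]
    exact mul_le_mul_of_nonneg_left (hAn n) (by positivity)
  -- The Herglotz integrand 2 Re Q(z) · ⟨(1 - A/z)⁻¹x, x⟩. Termwise averaging recovers the Taylor
  -- coefficients of Q, while the conjugate of Q contributes only at n = 0.
  let f : ℂ → ℂ := fun z => w z * inner ℂ x ((∑' n, (z⁻¹ • A) ^ n) x)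
  have key : HasSum (fun n => Real.circleAverage (fun z => w z * z⁻¹ ^ n * a n) 0 R)
      (Real.circleAverage f 0 R) := by
    refine hasSum_circleAverage (b := fun n => 2 * M * (2 * ‖x‖ ^ 2) * (r / R) ^ n) hR0.le
      (fun n => (hw.mul (hpow n)).mul continuousOn_const) (fun n z hz => ?_)
      (hgeo.mul_left _) (fun z hz => ?_)
    · have h1 : ‖w z‖ ≤ 2 * M := (norm_add_le _ _).trans (by
        rw [RCLike.norm_conj]; linarith [hM z hz])
      have hM0 : 0 ≤ 2 * M := (norm_nonneg _).trans h1
      rw [mem_sphere_zero_iff_norm] at hz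
      rw [norm_mul, norm_mul, norm_pow, norm_inv, hz]
      calc ‖w z‖ * R⁻¹ ^ n * ‖a n‖ ≤ 2 * M * R⁻¹ ^ n * (2 * r ^ n * ‖x‖ ^ 2) := by
            gcongr; exact ha n
        _ = _ := by rw [div_pow, inv_pow]; ring
    · have h1 := ((ContinuousLinearMap.apply ℂ H x).hasSum (hsumB z hz).hasSum).mapL (innerSL ℂ x)
      simp only [mul_assoc]
      refine HasSum.mul_left (w z) ?_
      simpa [smul_pow, a, inner_smul_right] using h1
  have hcoef : ∀ n, Real.circleAverage (fun z => w z * z⁻¹ ^ n * a n) 0 R =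
      taylorCoeff Q n * a n + if n = 0 then conj (Q 0) * (‖x‖ : ℂ) ^ 2 else 0 := by
    intro n
    have i1 : CircleIntegrable (fun z => Q z * z⁻¹ ^ n) 0 R :=
      (hQc.mul (hpow n)).circleIntegrable hR0.le
    have i2 : CircleIntegrable (fun z => conj (Q z) * z⁻¹ ^ n) 0 R :=
      ((Complex.continuous_conj.comp_continuousOn hQc).mul (hpow n)).circleIntegrable hR0.le
    have h1 : (fun z => w z * z⁻¹ ^ n * a n) =
        fun z => a n • (Q z * z⁻¹ ^ n + conj (Q z) * z⁻¹ ^ n) := by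
      funext z; simp only [w, smul_eq_mul]; ring
    rw [h1, Real.circleAverage_fun_smul, Real.circleAverage_fun_add i1 i2,
      circleAverage_mul_inv_pow hQ hR0 hR1, circleAverage_conj_mul_inv_pow hQ hR0 hR1, smul_eq_mul]
    rcases eq_or_ne n 0 with rfl | hn
    · have : a 0 = (‖x‖ : ℂ) ^ 2 := by simp [a]
      simp only [if_true, this]; ring
    · simp only [if_neg hn]; ring
  have hop : HasSum (fun n => taylorCoeff Q n * a n) (inner ℂ x (holoCalc Q A x)) := by
    have h0 := ((hT.hasDiskCalc hr0 hr1) Q hQ).of_norm.hasSum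
    rw [← hA] at h0
    have h1 := ((ContinuousLinearMap.apply ℂ H x).hasSum h0).mapL (innerSL ℂ x)
    simpa [a, inner_smul_right, holoCalc] using h1
  simp only [hcoef] at key
  have htot := key.unique (hop.add (hasSum_ite_eq 0 (conj (Q 0) * (‖x‖ : ℂ) ^ 2)))
  have hfre : ∀ z ∈ Metric.sphere (0 : ℂ) R, 0 ≤ (f z).re := by
    intro z hz
    have h1 : w z = ((2 * (Q z).re : ℝ) : ℂ) := by simp only [w, Complex.add_conj]
    have h2 : z⁻¹ • A = (z⁻¹ * r) • T := by rw [hA, smul_smul]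
    have h3 : NumRadiusLeOne (z⁻¹ • A) := by
      rw [h2]
      refine hT.smul ?_
      rw [mem_sphere_zero_iff_norm] at hz
      rw [norm_mul, norm_inv, hz, Complex.norm_real, Real.norm_eq_abs, abs_of_nonneg hr0,
        inv_mul_eq_div]
      exact hq.le
    simp only [f, h1]
    rw [Complex.re_ofReal_mul]
    exact mul_nonneg (by linarith [hre z (hsph z hz)])
      (h3.re_inner_tsum_pow_nonneg (hsumB z hz) x)
  have hfre' : 0 ≤ (Real.circleAverage f 0 R).re := by
    -- Without integrability the average is 0 by convention, so positivity still holds.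
    by_cases hint : CircleIntegrable f 0 R
    · have h1 := ContinuousLinearMap.circleAverage_comp_comm Complex.reCLM hint
      have h2 : Complex.reCLM (Real.circleAverage f 0 R) = (Real.circleAverage f 0 R).re := rfl
      rw [← h2, ← h1]
      refine Real.circleAverage_nonneg_of_nonneg fun z hz => ?_
      rw [abs_of_pos hR0] at hz
      exact hfre z hz
    · rw [Real.circleAverage.integral_undef hint, Complex.zero_re]
  rw [htot, Complex.add_re, ← Complex.ofReal_pow, mul_comm (conj (Q 0)), Complex.re_ofReal_mul,
    Complex.conj_re] at hfre'
  linarith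

end

/-! ### The Möbius inequality, Berger–Stampfli, and the half-plane estimate. -/

section

variable {H : Type*} [NormedAddCommGroup H] [InnerProductSpace ℂ H]

lemma NumRadiusLeOne.re_inner_mobius_le {S : H →L[ℂ] H} (hS : NumRadiusLeOne S) {α : ℂ}
    (hα : ‖α‖ ≤ 1) (y : H) :
    (inner ℂ (y + conj α • S y) (α • y + S y)).re ≤
      max 1 (α.re + 1 - ‖α‖ ^ 2) * ‖y + conj α • S y‖ ^ 2 := by
  have hα2 : ‖α‖ ^ 2 ≤ 1 := pow_le_one₀ (norm_nonneg _) hα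
  have hcs : ‖inner ℂ y (S y)‖ ^ 2 ≤ ‖y‖ ^ 2 * ‖S y‖ ^ 2 := by
    rw [← mul_pow]
    exact pow_le_pow_left₀ (norm_nonneg _) (norm_inner_le_norm _ _) 2
  obtain ⟨u, hu, hus⟩ := exists_norm_one_mul_eq_norm (inner ℂ y (S y))
  have hA := fun {c : ℝ} (h0 : 0 ≤ c) (h1 : c ≤ 1) =>
    (hS.smul hu.le).norm_sq_apply_le h0 h1 y
  simp only [smul_apply, norm_smul, hu, one_mul, inner_smul_right, hus, Complex.ofReal_re] at hA
  have hw := hS y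
  have e1 : inner ℂ (y + conj α • S y) (α • y + S y) =
      α * ((‖y‖ ^ 2 : ℝ) : ℂ) + inner ℂ y (S y) + α ^ 2 * conj (inner ℂ y (S y))
        + α * ((‖S y‖ ^ 2 : ℝ) : ℂ) := by
    simp only [inner_add_left, inner_add_right, inner_smul_left, inner_smul_right,
      Complex.conj_conj, inner_self_eq_ofReal, inner_conj_symm]
    ring
  have e2 : ‖y + conj α • S y‖ ^ 2 =
      ‖y‖ ^ 2 + 2 * (conj α * inner ℂ y (S y)).re + ‖α‖ ^ 2 * ‖S y‖ ^ 2 := by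
    rw [norm_add_sq (𝕜 := ℂ), inner_smul_right, norm_smul, RCLike.norm_conj, mul_pow]
    rfl
  have hpos : 0 ≤ ‖y + conj α • S y‖ ^ 2 := by positivity
  have hn : 0 ≤ ‖y‖ ^ 2 := by positivity
  have hq : 0 ≤ ‖S y‖ ^ 2 := by positivity
  rw [e1]
  rw [e2] at hpos ⊢
  generalize inner ℂ y (S y) = s at *
  generalize ‖y‖ ^ 2 = n at *
  generalize ‖S y‖ ^ 2 = q at *
  clear e1 e2 hus
  have hb2 : ‖2 * conj α - 1‖ ^ 2 = 1 - 4 * (α.re - ‖α‖ ^ 2) := by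
    rw [Complex.sq_norm, Complex.sq_norm, Complex.normSq_apply, Complex.normSq_apply]
    simp
    ring
  have hm2 : ‖1 - conj α‖ ^ 2 = 1 - 2 * α.re + ‖α‖ ^ 2 := by
    rw [Complex.sq_norm, Complex.sq_norm, Complex.normSq_apply, Complex.normSq_apply]
    simp
    ring
  have hre : α.re ≤ 1 := (Complex.re_le_norm α).trans hα
  rcases le_or_gt α.re (‖α‖ ^ 2) with h | h
  · have hre2 : ((1 - conj α) ^ 2 * s).re ≤ (1 - 2 * α.re + ‖α‖ ^ 2) * ‖s‖ := by
      rw [← hm2, ← norm_pow, ← norm_mul]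
      exact Complex.re_le_norm _
    -- Multiply by n and use |s|² ≤ nq; the result factors through n - |s| ≥ 0. The weights here sum
    -- to |1 - α|², matching `hre2`.
    have hk : 0 ≤ (1 - α.re) * (n - ‖s‖) + (‖α‖ ^ 2 - α.re) * (q - ‖s‖) := by
      rcases hn.eq_or_lt with hn0 | hn0
      · have hs0 : ‖s‖ = 0 := le_antisymm (hw.trans hn0.symm.le) (norm_nonneg _)
        rw [hs0, ← hn0, sub_zero, sub_zero, mul_zero, zero_add]
        exact mul_nonneg (by linarith) hq
      · have h1 : 0 ≤ (n - ‖s‖) * ((1 - α.re) * n - (‖α‖ ^ 2 - α.re) * ‖s‖) := by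
          refine mul_nonneg (by linarith) ?_
          nlinarith [norm_nonneg s]
        have h2 : 0 ≤ n * ((1 - α.re) * (n - ‖s‖) + (‖α‖ ^ 2 - α.re) * (q - ‖s‖)) := by
          nlinarith
        exact nonneg_of_mul_nonneg_right h2 hn0
    have h1 := mul_le_mul_of_nonneg_right (le_max_left 1 (α.re + 1 - ‖α‖ ^ 2)) hpos
    refine le_trans ?_ h1
    simp only [pow_two, Complex.add_re, Complex.mul_re, Complex.mul_im, Complex.sub_re,
      Complex.sub_im, Complex.conj_re, Complex.conj_im, Complex.ofReal_re, Complex.ofReal_im,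
      Complex.one_re, Complex.one_im] at hre2 hk ⊢
    nlinarith
  · have ht : ‖2 * conj α - 1‖ ≤ 1 := by
      refine abs_le_of_sq_le_sq' (?_ : ‖2 * conj α - 1‖ ^ 2 ≤ 1 ^ 2) zero_le_one |>.2
      rw [hb2]; linarith
    -- The choice c = |2ᾱ - 1| gives (1 - c²)/4 = Re α - |α|², exactly the coefficient of ‖Sy‖² in
    -- `h3`.
    have h1 := hA (norm_nonneg _) ht
    rw [hb2] at h1
    have h2 : -((2 * conj α - 1) * s).re ≤ ‖2 * conj α - 1‖ * ‖s‖ := by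
      rw [← norm_mul]
      exact (neg_le_abs _).trans (Complex.abs_re_le_norm _)
    have h3 : 0 ≤ (1 - ‖α‖ ^ 2) *
        (n + ((2 * conj α - 1) * s).re - (α.re - ‖α‖ ^ 2) * q) :=
      mul_nonneg (by linarith) (by linarith)
    rw [max_eq_right (by linarith)]
    have hsq : ‖α‖ ^ 2 = α.re * α.re + α.im * α.im := by
      rw [Complex.sq_norm, Complex.normSq_apply]
    rw [hsq] at h3 ⊢
    simp only [pow_two, Complex.add_re, Complex.mul_re, Complex.mul_im, Complex.sub_re,
      Complex.sub_im, Complex.conj_re, Complex.conj_im, Complex.ofReal_re, Complex.ofReal_im,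
      Complex.one_re, Complex.one_im, Complex.re_ofNat, Complex.im_ofNat] at h3 ⊢
    linarith

variable [CompleteSpace H]

/-- The Cayley transform (1 + g)/(1 - g) = K - 1 has nonnegative real part and value 1 at 0. The
Herglotz inequality at the vector (1 - g(A))y loses its quadratic terms, leaving 2 Re⟨y, (1 -
g(A))y⟩ ≥ 0. -/
lemma NumRadiusLeOne.re_inner_holoCalc_le {T : H →L[ℂ] H} (hT : NumRadiusLeOne T) {r : ℝ}
    (hr0 : 0 ≤ r) (hr1 : r < 1) {g : ℂ → ℂ} (hg : DifferentiableOn ℂ g (Metric.ball 0 1))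
    (hmaps : Set.MapsTo g (Metric.ball 0 1) (Metric.ball 0 1)) (hg0 : g 0 = 0) (y : H) :
    (inner ℂ y (holoCalc g ((r : ℂ) • T) y)).re ≤ ‖y‖ ^ 2 := by
  have hA := hT.hasDiskCalc hr0 hr1
  obtain ⟨A, hAdef⟩ : ∃ A, A = (r : ℂ) • T := ⟨_, rfl⟩
  have hlt : ∀ z ∈ Metric.ball (0 : ℂ) 1, ‖g z‖ < 1 := fun z hz => by simpa using hmaps hz
  have hne : ∀ z ∈ Metric.ball (0 : ℂ) 1, 1 - g z ≠ 0 := fun z hz h => by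
    have := hlt z hz
    rw [← sub_eq_zero.mp h] at this
    simp at this
  let K : ℂ → ℂ := fun z => 2 / (1 - g z)
  have h1g : DifferentiableOn ℂ (fun z => 1 - g z) (Metric.ball 0 1) := hg.const_sub 1
  have hK : DifferentiableOn ℂ K (Metric.ball 0 1) := (differentiableOn_const _).div h1g hne
  have hre : ∀ z ∈ Metric.ball (0 : ℂ) 1, 0 ≤ (K z - 1).re := by
    intro z hz
    have h1 : K z - 1 = (1 + g z) / (1 - g z) := by
      simp only [K]; field_simp [hne z hz]; ring
    have h2 := hlt z hz
    have h3 : (g z).re * (g z).re + (g z).im * (g z).im < 1 := by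
      rw [← Complex.normSq_apply, ← Complex.sq_norm]
      exact pow_lt_one₀ (norm_nonneg _) h2 two_ne_zero
    rw [h1, Complex.div_re, ← add_div]
    refine div_nonneg ?_ (Complex.normSq_nonneg _)
    simp
    nlinarith
  have hmain := hT.re_inner_holoCalc_nonneg hr0 hr1 (hK.sub_const 1) hre
    ((1 - holoCalc g A) y)
  have hc : DifferentiableOn ℂ (fun _ : ℂ => (1 : ℂ)) (Metric.ball 0 1) := differentiableOn_const _
  have hK0 : K 0 - 1 = 1 := by simp only [K, hg0]; norm_num
  rw [hK0, ← hAdef, holoCalc_sub (hAdef ▸ hA) hK hc, holoCalc_const, one_smul] at hmain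
  have hprod : holoCalc K A * (1 - holoCalc g A) = (2 : ℂ) • 1 := by
    have h1 := holoCalc_sub (hAdef ▸ hA) hc hg
    rw [holoCalc_const, one_smul] at h1
    rw [← h1, ← holoCalc_mul (hAdef ▸ hA) hK h1g, ← holoCalc_const]
    refine holoCalc_congr (fun z hz => ?_) A
    exact div_mul_cancel₀ _ (hne z hz)
  have hKx : holoCalc K A ((1 - holoCalc g A) y) = (2 : ℂ) • y :=
    congrArg (fun B : H →L[ℂ] H => B y) hprod
  rw [sub_apply (holoCalc K A), hKx, one_apply_eq_self, inner_sub_right, inner_self_eq_ofReal,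
    inner_smul_right, Complex.sub_re, Complex.ofReal_re, Complex.one_re, one_mul, sub_add_cancel,
    Complex.mul_re, Complex.re_ofNat, Complex.im_ofNat, zero_mul, sub_zero, sub_apply,
    one_apply_eq_self, inner_sub_left, inner_self_eq_ofReal, Complex.sub_re, Complex.ofReal_re,
    ← inner_conj_symm, Complex.conj_re] at hmain
  rw [← hAdef]
  linarith

/-- The Berger–Stampfli theorem. -/
lemma NumRadiusLeOne.holoCalc {T : H →L[ℂ] H} (hT : NumRadiusLeOne T) {r : ℝ}
    (hr0 : 0 ≤ r) (hr1 : r < 1) {g : ℂ → ℂ} (hg : DifferentiableOn ℂ g (Metric.ball 0 1))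
    (hmaps : Set.MapsTo g (Metric.ball 0 1) (Metric.ball 0 1)) (hg0 : g 0 = 0) :
    NumRadiusLeOne (holoCalc g ((r : ℂ) • T)) := by
  refine NumRadiusLeOne.of_forall_re fun u hu y => ?_
  rw [← holoCalc_const_mul hg]
  refine hT.re_inner_holoCalc_le hr0 hr1 (hg.const_mul u) (fun z hz => ?_) (by simp [hg0]) y
  have := hmaps hz
  rw [mem_ball_zero_iff] at this ⊢
  rwa [norm_mul, hu, one_mul]

/-- Berger–Stampfli for h/M, combined with the factor 2 between norm and numerical radius. -/
lemma NumRadiusLeOne.norm_holoCalc_le {T : H →L[ℂ] H} (hT : NumRadiusLeOne T) {r : ℝ}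
    (hr0 : 0 ≤ r) (hr1 : r < 1) {h : ℂ → ℂ} (hh : DifferentiableOn ℂ h (Metric.ball 0 1))
    (hh0 : h 0 = 0) {M : ℝ} (hM : 0 < M) (hle : ∀ z ∈ Metric.ball (0 : ℂ) 1, ‖h z‖ < M) :
    ‖Drury.holoCalc h ((r : ℂ) • T)‖ ≤ 2 * M := by
  have hMc : ‖(M : ℂ)⁻¹‖ = M⁻¹ := by
    rw [norm_inv, Complex.norm_real, Real.norm_eq_abs, abs_of_pos hM]
  have h1 := (hT.holoCalc hr0 hr1 (hh.const_mul (M : ℂ)⁻¹) (fun z hz => by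
    rw [mem_ball_zero_iff, norm_mul, hMc, inv_mul_lt_one₀ hM]
    exact hle z hz) (by simp [hh0])).norm_le_two
  rw [holoCalc_const_mul hh, norm_smul, hMc, inv_mul_le_iff₀ hM] at h1
  linarith

/-- Drury's estimate for a single half-plane. -/
lemma NumRadiusLeOne.re_inner_holoCalc_le_max {T : H →L[ℂ] H} (hT : NumRadiusLeOne T) {r : ℝ}
    (hr0 : 0 ≤ r) (hr1 : r < 1) {F : ℂ → ℂ} (hF : DifferentiableOn ℂ F (Metric.ball 0 1))
    (hmaps : Set.MapsTo F (Metric.ball 0 1) (Metric.ball 0 1)) (x : H) :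
    (inner ℂ x (Drury.holoCalc F ((r : ℂ) • T) x)).re ≤
      max 1 ((F 0).re + 1 - ‖F 0‖ ^ 2) * ‖x‖ ^ 2 := by
  obtain ⟨A, hAdef⟩ : ∃ A, A = (r : ℂ) • T := ⟨_, rfl⟩
  have hA : HasDiskCalc A := hAdef ▸ hT.hasDiskCalc hr0 hr1
  have hlt : ∀ z ∈ Metric.ball (0 : ℂ) 1, ‖F z‖ < 1 := fun z hz => by simpa using hmaps hz
  obtain ⟨α, hα⟩ : ∃ α, α = F 0 := ⟨_, rfl⟩
  have hα1 : ‖α‖ < 1 := hα ▸ hlt 0 (by simp)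
  have hne : ∀ z ∈ Metric.ball (0 : ℂ) 1, 1 - conj α * F z ≠ 0 := fun z hz h => by
    have h1 : ‖conj α * F z‖ < 1 := by
      rw [norm_mul, RCLike.norm_conj]
      exact mul_lt_one_of_nonneg_of_lt_one_left (norm_nonneg _) hα1 (hlt z hz).le
    rw [← sub_eq_zero.mp h] at h1
    simp at h1
  have hd : 1 - conj α * α ≠ 0 := hα ▸ hne 0 (by simp)
  let g : ℂ → ℂ := fun z => (F z - α) / (1 - conj α * F z)
  -- k = 1/(1 + ᾱg), so y = k(A)x solves x = (1 + ᾱS)y with S = g(A).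
  let k : ℂ → ℂ := fun z => (1 - conj α * α)⁻¹ * (1 - conj α * F z)
  have h1F : DifferentiableOn ℂ (fun z => 1 - conj α * F z) (Metric.ball 0 1) :=
    (hF.const_mul _).const_sub 1
  have hg : DifferentiableOn ℂ g (Metric.ball 0 1) := (hF.sub_const α).div h1F hne
  have hk : DifferentiableOn ℂ k (Metric.ball 0 1) := h1F.const_mul _
  have hgk : DifferentiableOn ℂ (fun z => g z * k z) (Metric.ball 0 1) := hg.mul hk
  have hgmaps : Set.MapsTo g (Metric.ball 0 1) (Metric.ball 0 1) := by
    intro z hz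
    have h1 : 0 < ‖1 - conj α * F z‖ := norm_pos_iff.mpr (hne z hz)
    rw [mem_ball_zero_iff, norm_div, div_lt_one h1]
    refine lt_of_pow_lt_pow_left₀ 2 h1.le ?_
    have h2 : ‖F z‖ ^ 2 < 1 := pow_lt_one₀ (norm_nonneg _) (hlt z hz) two_ne_zero
    have h3 : ‖α‖ ^ 2 < 1 := pow_lt_one₀ (norm_nonneg _) hα1 two_ne_zero
    have h4 := mul_pos (sub_pos.mpr h2) (sub_pos.mpr h3)
    simp only [Complex.sq_norm, Complex.normSq_apply] at h4 ⊢
    simp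
    nlinarith
  have hS := hT.holoCalc hr0 hr1 hg hgmaps (by simp [g, hα])
  rw [← hAdef] at hS ⊢
  have e1 : Drury.holoCalc k A + conj α • (Drury.holoCalc g A * Drury.holoCalc k A) = 1 := by
    rw [← holoCalc_mul hA hg hk, ← holoCalc_const_mul hgk, ← holoCalc_add hA hk (hgk.const_mul _),
      ← one_smul ℂ (1 : H →L[ℂ] H), ← holoCalc_const]
    refine holoCalc_congr (fun z hz => ?_) A
    have := hne z hz
    simp only [g, k]
    field_simp
    ring
  have e2 : α • Drury.holoCalc k A + Drury.holoCalc g A * Drury.holoCalc k A =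
      Drury.holoCalc F A := by
    rw [← holoCalc_mul hA hg hk, ← holoCalc_const_mul hk, ← holoCalc_add hA (hk.const_mul _) hgk]
    refine holoCalc_congr (fun z hz => ?_) A
    have := hne z hz
    have h1 : g z * k z = (1 - conj α * α)⁻¹ * (F z - α) := by
      rw [mul_left_comm, div_mul_cancel₀ _ this]
    simp only [h1, k]
    linear_combination F z * inv_mul_cancel₀ hd
  have key := hS.re_inner_mobius_le hα1.le (Drury.holoCalc k A x)
  have e1x : Drury.holoCalc k A x + conj α • Drury.holoCalc g A (Drury.holoCalc k A x) = x :=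
    congrArg (fun B : H →L[ℂ] H => B x) e1
  have e2x : α • Drury.holoCalc k A x + Drury.holoCalc g A (Drury.holoCalc k A x) =
      Drury.holoCalc F A x := congrArg (fun B : H →L[ℂ] H => B x) e2
  rwa [e1x, e2x, hα] at key

/-! ### Geometry of the teardrop. -/

lemma isCompact_teardrop {α : ℂ} (hα : ‖α‖ ≤ 1) : IsCompact (teardrop α) := by
  have hα2 : 0 ≤ 1 - ‖α‖ ^ 2 := sub_nonneg.mpr (pow_le_one₀ (norm_nonneg α) hα)
  have h := (isCompact_Icc (a := (0 : ℝ)) (b := 1)).prod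
    ((isCompact_closedBall (0 : ℂ) 1).prod (isCompact_closedBall α (1 - ‖α‖ ^ 2)))
  convert h.image (f := fun p : ℝ × ℂ × ℂ => AffineMap.lineMap p.2.1 p.2.2 p.1)
    (by simp only [AffineMap.lineMap_apply_module]; fun_prop) using 1
  rw [teardrop, (convex_closedBall _ _).convexHull_union (convex_closedBall _ _)
    (Metric.nonempty_closedBall.mpr zero_le_one) (Metric.nonempty_closedBall.mpr hα2)]
  ext z
  simp only [mem_convexJoin, segment_eq_image_lineMap, Set.mem_image, Set.mem_prod, Prod.exists]
  constructor
  · rintro ⟨a, ha, b, hb, t, ht, rfl⟩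
    exact ⟨t, a, b, ⟨ht, ha, hb⟩, rfl⟩
  · rintro ⟨t, a, b, ⟨ht, ha, hb⟩, rfl⟩
    exact ⟨a, ha, b, hb, t, ht, rfl⟩

lemma mem_teardrop_of_forall_re_le {α c : ℂ} (hα : ‖α‖ ≤ 1)
    (h : ∀ u : ℂ, ‖u‖ = 1 → (u * c).re ≤ max 1 ((u * α).re + 1 - ‖α‖ ^ 2)) : c ∈ teardrop α := by
  by_contra hc
  obtain ⟨l, b, hlc, hlt⟩ := geometric_hahn_banach_point_closed (convex_convexHull ℝ _)
    (isCompact_teardrop hα).isClosed hc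
  obtain ⟨w, hw⟩ : ∃ w : ℂ, ∀ z, l z = -(w * z).re := by
    refine ⟨-(l 1 - l Complex.I * Complex.I), fun z => ?_⟩
    have hz : z = z.re • (1 : ℂ) + z.im • Complex.I := by simp [Complex.re_add_im]
    conv_lhs => rw [hz, map_add, map_smul, map_smul]
    simp
    ring
  have hα2 : 0 ≤ 1 - ‖α‖ ^ 2 := sub_nonneg.mpr (pow_le_one₀ (norm_nonneg α) hα)
  have hw0 : w ≠ 0 := by
    rintro rfl
    have h0 : (0 : ℂ) ∈ teardrop α := subset_convexHull ℝ _ (Or.inl (by simp))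
    have := hlt 0 h0
    rw [hw] at this hlc
    simp at this hlc
    linarith
  have hw1 : 0 < ‖w‖ := norm_pos_iff.mpr hw0
  obtain ⟨u, hu, hwu⟩ : ∃ u : ℂ, ‖u‖ = 1 ∧ w = ‖w‖ * u := by
    refine ⟨w / ‖w‖, by simp [hw0], ?_⟩
    have : (‖w‖ : ℂ) ≠ 0 := by exact_mod_cast hw1.ne'
    field_simp
  have hlu : ∀ z, l z = -(‖w‖ * (u * z).re) := fun z => by
    conv_lhs => rw [hw, hwu, mul_assoc, Complex.re_ofReal_mul]
  have hconj : u * conj u = 1 := by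
    rw [Complex.mul_conj, Complex.normSq_eq_norm_sq, hu]; simp
  -- The separating functional is tested at the points of the two disks where Re(uz) is largest.
  have h1 := hlt (conj u) (subset_convexHull ℝ _ (Or.inl (by simp [hu])))
  have h2 := hlt (α + ((1 - ‖α‖ ^ 2 : ℝ) : ℂ) * conj u) (subset_convexHull ℝ _ (Or.inr (by
    rw [mem_closedBall_iff_norm, add_sub_cancel_left, norm_mul, Complex.norm_real,
      RCLike.norm_conj, hu, Real.norm_eq_abs, abs_of_nonneg hα2, mul_one])))
  rw [hlu] at h1 h2 hlc
  have e2 : u * (α + ((1 - ‖α‖ ^ 2 : ℝ) : ℂ) * conj u) = u * α + ((1 - ‖α‖ ^ 2 : ℝ) : ℂ) := by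
    linear_combination ((1 - ‖α‖ ^ 2 : ℝ) : ℂ) * hconj
  rw [hconj, Complex.one_re] at h1
  rw [e2, Complex.add_re, Complex.ofReal_re] at h2
  rcases le_max_iff.mp (h u hu) with h3 | h3
  · nlinarith
  · nlinarith

end

/-! ### The limit r → 1 and passage to the closed disk. -/

section

variable {H : Type*} [NormedAddCommGroup H] [InnerProductSpace ℂ H] [CompleteSpace H]

lemma NumRadiusLeOne.exists_tendsto_holoCalc {T : H →L[ℂ] H} (hT : NumRadiusLeOne T) {f : ℂ → ℂ}
    (hcont : ContinuousOn f (Metric.closedBall 0 1))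
    (hf : DifferentiableOn ℂ f (Metric.ball 0 1)) :
    ∃ L, Tendsto (fun r : ℝ => Drury.holoCalc f ((r : ℂ) • T)) (𝓝[<] (1 : ℝ)) (𝓝 L) := by
  rw [← cauchy_map_iff_exists_tendsto, Metric.cauchy_iff]
  refine ⟨inferInstance, fun ε hε => ?_⟩
  have huc := (isCompact_closedBall (0 : ℂ) 1).uniformContinuousOn_of_continuous hcont
  obtain ⟨δ, hδ, hδ'⟩ := Metric.uniformContinuousOn_iff.mp huc (ε / 4) (by positivity)
  have hmem : Set.Ioo (max (1 / 2) (1 - δ / 2)) 1 ∈ 𝓝[<] (1 : ℝ) :=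
    Ioo_mem_nhdsLT (max_lt (by norm_num) (by linarith))
  refine ⟨_, image_mem_map hmem, ?_⟩
  rintro _ ⟨r, hr, rfl⟩ _ ⟨s, hs, rfl⟩
  obtain ⟨⟨hr1, hr2⟩, hr3⟩ := And.intro (max_lt_iff.mp hr.1) hr.2
  obtain ⟨⟨hs1, hs2⟩, hs3⟩ := And.intro (max_lt_iff.mp hs.1) hs.2
  -- With r, s < ρ < 1, f(rT) - f(sT) = h(ρT) for h(z) = f(rz/ρ) - f(sz/ρ). This h vanishes at 0 and
  -- is small by uniform continuity; ρ > 1/2 absorbs the division by ρ.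
  obtain ⟨ρ, hρ, hρ1⟩ := exists_between (max_lt hr3 hs3)
  obtain ⟨hrρ, hsρ⟩ := max_lt_iff.mp hρ
  have hρ0 : 0 < ρ := by linarith
  have hρc : (ρ : ℂ) ≠ 0 := by exact_mod_cast hρ0.ne'
  have hnorm : ∀ t : ℝ, 0 < t → t < ρ → ‖(t / ρ : ℂ)‖ ≤ 1 := fun t h0 h1 => by
    rw [norm_div, Complex.norm_real, Complex.norm_real, Real.norm_eq_abs, Real.norm_eq_abs,
      abs_of_pos h0, abs_of_pos hρ0]
    exact (div_le_one hρ0).mpr h1.le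
  have hnr := hnorm r (by linarith) hrρ
  have hns := hnorm s (by linarith) hsρ
  have hmaps : ∀ c : ℂ, ‖c‖ ≤ 1 → ∀ z ∈ Metric.ball (0 : ℂ) 1, c * z ∈ Metric.ball (0 : ℂ) 1 := by
    intro c hc z hz
    rw [mem_ball_zero_iff] at hz ⊢
    rw [norm_mul]
    exact mul_lt_one_of_nonneg_of_lt_one_right hc (norm_nonneg _) hz
  have hdiff : ∀ c : ℂ, ‖c‖ ≤ 1 → DifferentiableOn ℂ (fun z => f (c * z)) (Metric.ball 0 1) :=
    fun c hc => hf.comp (differentiableOn_id.const_mul c) (hmaps c hc)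
  have hb : ∀ z ∈ Metric.ball (0 : ℂ) 1, ‖f (r / ρ * z) - f (s / ρ * z)‖ < ε / 4 := by
    intro z hz
    rw [← dist_eq_norm]
    refine hδ' _ (Metric.ball_subset_closedBall (hmaps _ hnr z hz)) _
      (Metric.ball_subset_closedBall (hmaps _ hns z hz)) ?_
    rw [mem_ball_zero_iff] at hz
    rw [dist_eq_norm, ← sub_mul, ← sub_div, ← Complex.ofReal_sub, norm_mul, norm_div,
      Complex.norm_real, Complex.norm_real, Real.norm_eq_abs, Real.norm_eq_abs, abs_of_pos hρ0]
    have h1 : |r - s| < δ / 2 := abs_lt.mpr ⟨by linarith, by linarith⟩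
    calc |r - s| / ρ * ‖z‖ ≤ |r - s| / ρ * 1 := by gcongr
      _ < δ := by rw [mul_one, div_lt_iff₀ hρ0]; nlinarith
  have h1 := hT.norm_holoCalc_le hρ0.le hρ1 ((hdiff _ hnr).sub (hdiff _ hns)) (by simp)
    (by positivity) hb
  have h2 := holoCalc_sub (hT.hasDiskCalc hρ0.le hρ1) (hdiff _ hnr) (hdiff _ hns)
  rw [holoCalc_comp_const_mul hf hnr, holoCalc_comp_const_mul hf hns, smul_smul, smul_smul,
    div_mul_cancel₀ _ hρc, div_mul_cancel₀ _ hρc] at h2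
  rw [dist_eq_norm, ← h2]
  refine lt_of_le_of_lt h1 ?_
  linarith

lemma NumRadiusLeOne.re_mul_inner_holoCalc_le {T : H →L[ℂ] H} (hT : NumRadiusLeOne T)
    {r : ℝ} (hr0 : 0 ≤ r) (hr1 : r < 1) {f : ℂ → ℂ} (hf : DifferentiableOn ℂ f (Metric.ball 0 1))
    (hmaps : Set.MapsTo f (Metric.ball 0 1) (Metric.closedBall 0 1)) {u : ℂ} (hu : ‖u‖ = 1)
    {x : H} (hx : ‖x‖ = 1) :
    (u * inner ℂ x (Drury.holoCalc f ((r : ℂ) • T) x)).re ≤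
      max 1 ((u * f 0).re + 1 - ‖f 0‖ ^ 2) := by
  -- The factor s < 1 pushes the values of uf into the open disk, as the half-plane estimate
  -- requires; then s → 1.
  have key : ∀ s ∈ Set.Ioo (0 : ℝ) 1,
      (s * u * inner ℂ x (Drury.holoCalc f ((r : ℂ) • T) x)).re ≤
        max 1 ((s * u * f 0).re + 1 - ‖s * u * f 0‖ ^ 2) := by
    intro s hs
    have hsu : ‖(s : ℂ) * u‖ < 1 := by
      rw [norm_mul, hu, Complex.norm_real, Real.norm_eq_abs, abs_of_pos hs.1, mul_one]
      exact hs.2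
    have h1 := hT.re_inner_holoCalc_le_max hr0 hr1 (hf.const_mul (s * u)) (fun z hz => by
      have h2 := hmaps hz
      rw [mem_closedBall_zero_iff] at h2
      rw [mem_ball_zero_iff, norm_mul]
      exact mul_lt_one_of_nonneg_of_lt_one_left (norm_nonneg _) hsu h2) x
    rwa [holoCalc_const_mul hf, smul_apply, inner_smul_right, hx, one_pow, mul_one] at h1
  have hev : ∀ᶠ s in 𝓝[<] (1 : ℝ), s ∈ Set.Ioo (0 : ℝ) 1 := Ioo_mem_nhdsLT one_pos
  have hl : Continuous fun s : ℝ => (s * u * inner ℂ x (Drury.holoCalc f ((r : ℂ) • T) x)).re := by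
    fun_prop
  have hr : Continuous fun s : ℝ => max 1 ((s * u * f 0).re + 1 - ‖s * u * f 0‖ ^ 2) := by
    fun_prop
  have := le_of_tendsto_of_tendsto ((hl.tendsto 1).mono_left nhdsWithin_le_nhds)
    ((hr.tendsto 1).mono_left nhdsWithin_le_nhds) (hev.mono key)
  simpa [hu] using this

end

end Drury

theorem theorem4p1 {H : Type*} [NormedAddCommGroup H] [InnerProductSpace ℂ H] [CompleteSpace H]
    (T : H →L[ℂ] H)
    (hT : Drury.numericalRange T ⊆ Metric.closedBall (0 : ℂ) 1)
    (f : ℂ → ℂ)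
    (hf_cont : ContinuousOn f (Metric.closedBall (0 : ℂ) 1))
    (hf_holo : DifferentiableOn ℂ f (Metric.ball (0 : ℂ) 1))
    (hf_maps : Set.MapsTo f (Metric.closedBall (0 : ℂ) 1) (Metric.closedBall (0 : ℂ) 1)) :
    (∀ r : ℝ, 0 ≤ r → r < 1 →
      Summable (fun n : ℕ => Drury.taylorCoeff f n • ((r : ℂ) • T) ^ n)) ∧
    Tendsto (fun r : ℝ => Drury.holoCalc f ((r : ℂ) • T)) (𝓝[<] (1 : ℝ))
      (𝓝 (Drury.diskCalc f T)) ∧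
    Drury.numericalRange (Drury.diskCalc f T) ⊆ Drury.teardrop (f 0) := by
  have hT' := Drury.numRadiusLeOne_of_numericalRange hT
  have hlim : Tendsto (fun r : ℝ => Drury.holoCalc f ((r : ℂ) • T)) (𝓝[<] (1 : ℝ))
      (𝓝 (Drury.diskCalc f T)) :=
    tendsto_nhds_limUnder (hT'.exists_tendsto_holoCalc hf_cont hf_holo)
  refine ⟨fun r hr0 hr1 => (hT'.hasDiskCalc hr0 hr1 f hf_holo).of_norm, hlim, ?_⟩
  rintro _ ⟨x, hx, rfl⟩
  have hf0 : ‖f 0‖ ≤ 1 := by simpa using hf_maps (Metric.mem_closedBall_self zero_le_one)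
  refine Drury.mem_teardrop_of_forall_re_le hf0 fun u hu => ?_
  have hcont : Continuous fun B : H →L[ℂ] H => (u * inner ℂ x (B x)).re := by fun_prop
  refine le_of_tendsto ((hcont.tendsto _).comp hlim) ?_
  filter_upwards [Ioo_mem_nhdsLT (zero_lt_one' ℝ)] with r hr
  exact hT'.re_mul_inner_holoCalc_le hr.1.le hr.2 hf_holo
    (hf_maps.mono_left Metric.ball_subset_closedBall) hu hx
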